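/- **Theorem (Lukacs theorem with densities).** Let $X$ and $Y$ be independent real random variables on a common probability space, each concentrated on $(0,\infty)$ and having there a density with respect to Lebesgue measure that is strictly positive at every point of $(0,\infty)$. If $U=X+Y$ and $V=X/(X+Y)$ are also independent, then there exist positive numbers $p,q,a$ such that $X\sim G(p,a)$ and $Y\sim G(q,a)$, where, for $r,c>0$, $G(r,c)$ denotes the gamma distribution, i.e. the probability distribution on $\mathbb{R}$ with density $$f(x)=\frac{c^r}{\Gamma(r)}\,x^{r-1}e^{-cx}\,\mathbf 1_{(0,\infty)}(x).$$ -/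

import Mathlib

open MeasureTheory ProbabilityTheory Set

open Filter Topology

section Laplace

variable {Ω : Type*} {mΩ : MeasurableSpace Ω} {μ : Measure Ω} [IsFiniteMeasure μ] {X : Ω → ℝ}

/-! Since `X = VU` and `Y = (1 - V)U`, the two independences give, for `t < 0`, `E[X^i e^{tX}] E[Y^j
e^{tY}] = E[U^{i+j} e^{tU}] E[V^i (1-V)^j]`. Orders one and two eliminate `U` and `Y`, leaving `M
M'' = k M'^2` for the Laplace transform `M` of `X`, where `k` depends only on the first two moments
of `V`, and `k > 1` because `V` is not constant. So `M / M'` is affine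
(`exists_mul_sub_eq_of_mul_eq_sq`) and `M` is a gamma transform (`eq_rpow_of_hasDerivAt`). The
logarithmic derivative for `Y` is proportional to that for `X`, hence the same rate `a`;
`Measure.ext_of_mgf_eqOn_Iio` recovers the laws. -/

theorem integrable_exp_mul_of_nonneg (hX : AEMeasurable X μ) (h0 : 0 ≤ᵐ[μ] X) {t : ℝ}
    (ht : t ≤ 0) : Integrable (fun ω => Real.exp (t * X ω)) μ := by
  refine Integrable.of_bound (C := 1) (by fun_prop) ?_
  filter_upwards [h0] with ω hω
  rw [Real.norm_eq_abs, Real.abs_exp, Real.exp_le_one_iff]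
  exact mul_nonpos_of_nonpos_of_nonneg ht hω

theorem Iio_subset_interior_integrableExpSet (hX : AEMeasurable X μ) (h0 : 0 ≤ᵐ[μ] X) :
    Iio 0 ⊆ interior (integrableExpSet X μ) :=
  interior_maximal (fun _ ht => integrable_exp_mul_of_nonneg hX h0 (le_of_lt ht)) isOpen_Iio

/-- The complex moment generating function of a nonnegative variable is continuous from the left
at the imaginary axis. -/
theorem tendsto_complexMGF_left (hX : AEMeasurable X μ) (h0 : 0 ≤ᵐ[μ] X) (y : ℝ) :
    Tendsto (fun s : ℝ => complexMGF X μ (s + y * Complex.I)) (𝓝[<] 0)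
      (𝓝 (complexMGF X μ (y * Complex.I))) := by
  refine tendsto_integral_filter_of_dominated_convergence (fun _ => 1) ?_ ?_
    (integrable_const _) ?_
  · exact Eventually.of_forall fun s => by fun_prop
  · filter_upwards [self_mem_nhdsWithin] with s hs
    filter_upwards [h0] with ω hω
    rw [Complex.norm_exp, Real.exp_le_one_iff]
    simpa using mul_nonpos_of_nonpos_of_nonneg (le_of_lt hs) hω
  · refine Eventually.of_forall fun ω => ?_
    have : Continuous fun s : ℝ => Complex.exp ((s + y * Complex.I) * X ω) := by fun_prop
    simpa using (this.tendsto 0).mono_left nhdsWithin_le_nhds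

theorem tendsto_mgf_left (hX : AEMeasurable X μ) (h0 : 0 ≤ᵐ[μ] X) :
    Tendsto (mgf X μ) (𝓝[<] 0) (𝓝 (mgf X μ 0)) := by
  have h := (Complex.continuous_re.tendsto _).comp (tendsto_complexMGF_left hX h0 0)
  have h2 := re_complexMGF_ofReal (X := X) (μ := μ) 0
  simp only [Complex.ofReal_zero] at h2
  simp only [Complex.ofReal_zero, zero_mul, add_zero, h2] at h
  exact h.congr fun s => re_complexMGF_ofReal s

/-- A finite measure on the half-line is determined by its Laplace transform. -/
theorem MeasureTheory.Measure.ext_of_mgf_eqOn_Iio {μ ν : Measure ℝ} [IsFiniteMeasure μ]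
    [IsFiniteMeasure ν] (hμ : ∀ᵐ x ∂μ, 0 ≤ x) (hν : ∀ᵐ x ∂ν, 0 ≤ x)
    (h : EqOn (mgf id μ) (mgf id ν) (Iio 0)) : μ = ν := by
  -- Identity theorem on the left half-plane; left limits then reach the imaginary axis, where the
  -- values are the characteristic functions.
  have hU : EqOn (complexMGF id μ) (complexMGF id ν) {z | z.re < 0} := by
    have an {ρ : Measure ℝ} [IsFiniteMeasure ρ] (hρ : ∀ᵐ x ∂ρ, 0 ≤ x) :
        AnalyticOnNhd ℂ (complexMGF id ρ) {z | z.re < 0} := fun z hz =>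
      analyticAt_complexMGF (Iio_subset_interior_integrableExpSet aemeasurable_id hρ hz)
    refine (an hμ).eqOn_of_preconnected_of_frequently_eq (an hν)
      (convex_halfSpace_re_lt 0).isPreconnected (z₀ := ((-1 : ℝ) : ℂ)) (by simp) ?_
    have ht : Tendsto (fun t : ℝ => (t : ℂ)) (𝓝[≠] (-1)) (𝓝[≠] ((-1 : ℝ) : ℂ)) := by
      refine tendsto_nhdsWithin_iff.2 ⟨(Complex.continuous_ofReal.tendsto _).mono_left
        nhdsWithin_le_nhds, ?_⟩
      filter_upwards [self_mem_nhdsWithin] with t ht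
      exact fun h => ht (Complex.ofReal_injective h)
    refine ht.frequently (Eventually.frequently ?_)
    filter_upwards [nhdsWithin_le_nhds (Iio_mem_nhds (show (-1 : ℝ) < 0 by norm_num))] with t ht
    rw [complexMGF_ofReal, complexMGF_ofReal, h ht]
  refine Measure.ext_of_charFun (funext fun y => ?_)
  rw [← complexMGF_id_mul_I, ← complexMGF_id_mul_I]
  refine tendsto_nhds_unique (tendsto_complexMGF_left aemeasurable_id hμ y)
    ((tendsto_complexMGF_left aemeasurable_id hν y).congr' ?_)
  filter_upwards [self_mem_nhdsWithin] with s hs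
  exact (hU (by simpa using hs)).symm

end Laplace

section Gamma

theorem measurable_gammaPDF (p a : ℝ) : Measurable (gammaPDF p a) :=
  (measurable_gammaPDFReal p a).ennreal_ofReal

theorem ae_nonneg_gammaMeasure (p a : ℝ) : ∀ᵐ x ∂gammaMeasure p a, 0 ≤ x := by
  rw [gammaMeasure, ae_withDensity_iff (measurable_gammaPDF p a)]
  refine Eventually.of_forall fun x hx => ?_
  by_contra! h
  exact hx (gammaPDF_of_neg h)

theorem mgf_id_gammaMeasure {p a t : ℝ} (hp : 0 < p) (ha : 0 < a) (ht : t < a) :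
    mgf id (gammaMeasure p a) t = (a / (a - t)) ^ p := by
  have hat : 0 < a - t := sub_pos.2 ht
  have e : ∀ x, (gammaPDF p a x).toReal = gammaPDFReal p a x := fun x =>
    ENNReal.toReal_ofReal (gammaPDFReal_nonneg hp ha x)
  rw [mgf, gammaMeasure, integral_withDensity_eq_integral_toReal_smul
    (measurable_gammaPDF p a) (ae_of_all _ fun _ => ENNReal.ofReal_lt_top)]
  simp only [e, id, smul_eq_mul]
  rw [← setIntegral_eq_integral_of_forall_compl_eq_zero (s := Ici 0), integral_Ici_eq_integral_Ioi]
  · have : ∀ x ∈ Ioi (0 : ℝ), gammaPDFReal p a x * Real.exp (t * x)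
        = a ^ p / Real.Gamma p * (x ^ (p - 1) * Real.exp (-((a - t) * x))) := by
      intro x hx
      rw [gammaPDFReal, if_pos (le_of_lt hx), mul_assoc, mul_assoc, ← Real.exp_add]
      ring_nf
    rw [setIntegral_congr_fun measurableSet_Ioi this, integral_const_mul,
      Real.integral_rpow_mul_exp_neg_mul_Ioi hp hat, Real.div_rpow ha.le hat.le,
      Real.div_rpow zero_le_one hat.le, Real.one_rpow]
    have := (Real.Gamma_pos_of_pos hp).ne'
    field_simp
  · intro x hx
    rw [gammaPDFReal, if_neg (show ¬ 0 ≤ x from hx), zero_mul]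

theorem hasLaw_gammaMeasure_of_mgf_eq {Ω : Type*} {mΩ : MeasurableSpace Ω} {P : Measure Ω}
    [IsFiniteMeasure P] {X : Ω → ℝ} (hX : AEMeasurable X P) (h0 : 0 ≤ᵐ[P] X) {p a : ℝ}
    (hp : 0 < p) (ha : 0 < a) (h : ∀ t < 0, mgf X P t = (a / (a - t)) ^ p) :
    HasLaw X (gammaMeasure p a) P := by
  have := isProbabilityMeasure_gammaMeasure hp ha
  refine ⟨hX, Measure.ext_of_mgf_eqOn_Iio ?_ (ae_nonneg_gammaMeasure p a) fun t ht => ?_⟩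
  · exact (ae_map_iff hX measurableSet_Ici).2 h0
  · rw [mgf_id_map hX, mgf_id_gammaMeasure hp ha (lt_trans ht ha), h t ht]

end Gamma

section ODE

theorem eq_of_hasDerivAt_zero_of_neg {F : ℝ → ℝ} (h : ∀ t < 0, HasDerivAt F 0 t) :
    ∃ C, ∀ t < 0, F t = C := by
  refine ⟨F (-1), fun t ht => ?_⟩
  exact isOpen_Iio.is_const_of_deriv_eq_zero (convex_Iio 0).isPreconnected
    (fun s hs => (h s hs).differentiableAt.differentiableWithinAt)
    (fun s hs => (h s hs).deriv) ht (show (-1 : ℝ) < 0 by norm_num)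

/-- `F t * (a - t) ^ p` has zero derivative, and the limit at `0` fixes the constant. If `a = 0`,
then `F` would vanish, against the limit `1`. -/
theorem eq_rpow_of_hasDerivAt {F F' : ℝ → ℝ} {a p : ℝ} (ha : 0 ≤ a) (hp : 0 < p)
    (hF : ∀ t < 0, HasDerivAt F (F' t) t) (h : ∀ t < 0, F' t * (a - t) = p * F t)
    (hlim : Tendsto F (𝓝[<] 0) (𝓝 1)) :
    0 < a ∧ ∀ t < 0, F t = (a / (a - t)) ^ p := by
  have hpos : ∀ t < 0, 0 < a - t := fun t ht => by linarith
  obtain ⟨C, hC⟩ := eq_of_hasDerivAt_zero_of_neg (F := fun t => F t * (a - t) ^ p) fun t ht => by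
    have h1 : HasDerivAt (fun s : ℝ => (a - s) ^ p) (-1 * p * (a - t) ^ (p - 1)) t :=
      ((hasDerivAt_id t).const_sub a).rpow_const (Or.inl (hpos t ht).ne')
    convert! (hF t ht).mul h1 using 1
    have h2 : (a - t) ^ p = (a - t) ^ (p - 1) * (a - t) := by
      rw [← Real.rpow_add_one (hpos t ht).ne', sub_add_cancel]
    rw [h2]
    linear_combination -((a - t) ^ (p - 1)) * h t ht
  have hlim' : Tendsto (fun t => F t * (a - t) ^ p) (𝓝[<] 0) (𝓝 (1 * (a - 0) ^ p)) := by
    refine hlim.mul (Tendsto.mono_left ?_ nhdsWithin_le_nhds)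
    exact ((continuous_const.sub continuous_id).rpow_const fun _ => Or.inr hp.le).tendsto 0
  have hCa : C = a ^ p := by
    rw [one_mul, sub_zero] at hlim'
    refine tendsto_nhds_unique (tendsto_const_nhds.congr' ?_) hlim'
    filter_upwards [self_mem_nhdsWithin] with t ht
    exact (hC t ht).symm
  have hFt : ∀ t < 0, F t = (a / (a - t)) ^ p := fun t ht => by
    rw [Real.div_rpow ha (hpos t ht).le, eq_div_iff (Real.rpow_pos_of_pos (hpos t ht) p).ne',
      ← hCa]
    exact hC t ht
  refine ⟨ha.lt_of_ne ?_, hFt⟩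
  rintro rfl
  refine zero_ne_one (α := ℝ) (tendsto_nhds_unique (tendsto_const_nhds.congr' ?_) hlim)
  filter_upwards [self_mem_nhdsWithin] with t ht
  rw [hFt t ht, zero_div, Real.zero_rpow hp.ne']

/-- If `M * M'' = k * M' ^ 2` with `1 < k`, then `M / M'` is affine. -/
theorem exists_mul_sub_eq_of_mul_eq_sq {M A B : ℝ → ℝ} {k : ℝ} (hk : 1 < k)
    (hM : ∀ t < 0, HasDerivAt M (A t) t) (hA : ∀ t < 0, HasDerivAt A (B t) t)
    (hMpos : ∀ t < 0, 0 < M t) (hApos : ∀ t < 0, 0 < A t)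
    (h : ∀ t < 0, B t * M t = k * A t ^ 2) :
    ∃ a, 0 ≤ a ∧ ∀ t < 0, A t * (a - t) = (k - 1)⁻¹ * M t := by
  have hk' : 0 < k - 1 := sub_pos.2 hk
  obtain ⟨a, ha⟩ := eq_of_hasDerivAt_zero_of_neg
      (F := fun t => (k - 1)⁻¹ * (M t / A t) + t) fun t ht => by
    have hne := (hApos t ht).ne'
    convert! (((hM t ht).div (hA t ht) hne).const_mul (k - 1)⁻¹).add (hasDerivAt_id t) using 1
    field_simp
    linear_combination h t ht
  refine ⟨a, ?_, fun t ht => ?_⟩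
  -- At `b / 2`, which lies in `(b, 0)`, the constant `a` is `b / 2` plus a positive term.
  · refine le_of_forall_lt fun b hb => ?_
    have := ha (b / 2) (by linarith)
    have h2 : 0 < (k - 1)⁻¹ * (M (b / 2) / A (b / 2)) :=
      mul_pos (inv_pos.2 hk') (div_pos (hMpos _ (by linarith)) (hApos _ (by linarith)))
    linarith
  · have hne := (hApos t ht).ne'
    rw [← ha t ht]
    field_simp
    ring

end ODE

section Moments

variable {Ω : Type*} {mΩ : MeasurableSpace Ω} {P : Measure Ω}

theorem integral_pos_of_ae_pos [NeZero P] {f : Ω → ℝ} (hf : Integrable f P)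
    (h : ∀ᵐ ω ∂P, 0 < f ω) : 0 < ∫ ω, f ω ∂P := by
  rw [integral_pos_iff_support_of_nonneg_ae (h.mono fun _ => le_of_lt) hf]
  have : Function.support f =ᵐ[P] univ := by
    filter_upwards [h] with ω hω
    exact eq_true hω.ne'
  rw [measure_congr this]
  exact NeZero.pos _

/-- One random variable, factored along two independent pairs. No integrability is needed. -/
theorem ProbabilityTheory.IndepFun.integral_mul_integral_eq_of_ae_eq {A B C D : Ω → ℝ}
    (hA : AEMeasurable A P) (hB : AEMeasurable B P) (hC : AEMeasurable C P)
    (hD : AEMeasurable D P) (hAB : IndepFun A B P) (hCD : IndepFun C D P) {f g h k : ℝ → ℝ}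
    (hf : Measurable f) (hg : Measurable g) (hh : Measurable h) (hk : Measurable k)
    (e : ∀ᵐ ω ∂P, f (A ω) * g (B ω) = h (C ω) * k (D ω)) :
    (∫ ω, f (A ω) ∂P) * ∫ ω, g (B ω) ∂P = (∫ ω, h (C ω) ∂P) * ∫ ω, k (D ω) ∂P := by
  rw [← hAB.integral_fun_comp_mul_comp hA hB hf.aestronglyMeasurable hg.aestronglyMeasurable,
    ← hCD.integral_fun_comp_mul_comp hC hD hh.aestronglyMeasurable hk.aestronglyMeasurable]
  exact integral_congr_ae e

/-- An atomless variable is almost surely different from any variable independent of it. -/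
theorem ProbabilityTheory.IndepFun.ae_ne [IsFiniteMeasure P] {A B : Ω → ℝ}
    (hA : AEMeasurable A P) (hB : AEMeasurable B P) (hAB : IndepFun A B P)
    [NullSingletonClass (P.map B)] : ∀ᵐ ω ∂P, A ω ≠ B ω := by
  have hs : MeasurableSet {p : ℝ × ℝ | p.1 = p.2} :=
    measurableSet_eq_fun measurable_fst measurable_snd
  have h : P.map (fun ω => (A ω, B ω)) {p : ℝ × ℝ | p.1 = p.2} = 0 := by
    rw [(indepFun_iff_map_prod_eq_prod_map_map hA hB).1 hAB, Measure.measure_prod_null hs]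
    refine Eventually.of_forall fun x => ?_
    have : Prod.mk x ⁻¹' {p : ℝ × ℝ | p.1 = p.2} = {x} := by
      ext y
      simp [eq_comm]
    simp [this]
  rw [Measure.map_apply_of_aemeasurable (hA.prodMk hB) hs] at h
  exact measure_eq_zero_iff_ae_notMem.1 h

end Moments

section Lukacs

variable {Ω : Type*} {mΩ : MeasurableSpace Ω} {P : Measure Ω} [IsProbabilityMeasure P]

/-- The second moment of a nondegenerate square-integrable variable exceeds the square of its
mean. -/
theorem sq_integral_lt_integral_sq {V : Ω → ℝ} (hV : MemLp V 2 P)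
    (hne : ¬ ∀ᵐ ω ∂P, V ω = ∫ ω, V ω ∂P) : (∫ ω, V ω ∂P) ^ 2 < ∫ ω, V ω ^ 2 ∂P := by
  have h : 0 < variance V P := (variance_nonneg V P).lt_of_ne fun h0 =>
    hne (ae_eq_integral_of_variance_eq_zero hV h0.symm)
  rw [variance_eq_sub hV] at h
  simpa using! h

/-- **Lukacs' theorem** for positive independent variables, one of which has no atoms. -/
theorem lukacs_of_ae_pos {X Y : Ω → ℝ} (hX : AEMeasurable X P) (hY : AEMeasurable Y P)
    (hX0 : ∀ᵐ ω ∂P, 0 < X ω) (hY0 : ∀ᵐ ω ∂P, 0 < Y ω) [NullSingletonClass (P.map Y)]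
    (hXY : IndepFun X Y P)
    (hUV : IndepFun (fun ω => X ω + Y ω) (fun ω => X ω / (X ω + Y ω)) P) :
    ∃ p q a : ℝ, 0 < p ∧ 0 < q ∧ 0 < a ∧
      HasLaw X (gammaMeasure p a) P ∧ HasLaw Y (gammaMeasure q a) P := by
  have hX0' : 0 ≤ᵐ[P] X := hX0.mono fun _ => le_of_lt
  have hY0' : 0 ≤ᵐ[P] Y := hY0.mono fun _ => le_of_lt
  set U : Ω → ℝ := fun ω => X ω + Y ω
  set V : Ω → ℝ := fun ω => X ω / (X ω + Y ω)
  have hU : AEMeasurable U P := hX.add hY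
  have hV : AEMeasurable V P := hX.div hU
  have hV01 : ∀ᵐ ω ∂P, 0 < V ω ∧ V ω < 1 := by
    filter_upwards [hX0, hY0] with ω h1 h2
    exact ⟨by positivity, (div_lt_one (by positivity)).2 (by linarith)⟩
  have hVU : ∀ᵐ ω ∂P, V ω * U ω = X ω ∧ (1 - V ω) * U ω = Y ω := by
    filter_upwards [hX0, hY0] with ω h1 h2
    have : V ω * U ω = X ω := div_mul_cancel₀ _ (by positivity)
    refine ⟨this, ?_⟩
    rw [sub_mul, this]
    simp [U]
  have hV2 : MemLp V 2 P := MemLp.of_bound hV.aestronglyMeasurable 1 (by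
    filter_upwards [hV01] with ω h
    rw [Real.norm_eq_abs, abs_le]
    constructor <;> linarith)
  have hVi : Integrable V P := hV2.integrable (by norm_num)
  have hVi2 : Integrable (fun ω => V ω ^ 2) P := hV2.integrable_sq
  set m := ∫ ω, V ω ∂P with hm
  set s := ∫ ω, V ω ^ 2 ∂P
  have hm' : ∫ ω, (1 - V ω) ∂P = 1 - m := by
    rw [integral_sub (integrable_const _) hVi]
    simp [hm]
  have hq : ∫ ω, V ω * (1 - V ω) ∂P = m - s := by
    simp_rw [mul_sub, mul_one, ← pow_two]
    exact integral_sub hVi hVi2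
  have m_pos : 0 < m := integral_pos_of_ae_pos hVi (hV01.mono fun _ h => h.1)
  have m_lt : 0 < 1 - m := hm' ▸ integral_pos_of_ae_pos ((integrable_const _).sub hVi)
    (hV01.mono fun _ h => sub_pos.2 h.2)
  have q_pos : 0 < m - s := hq ▸ integral_pos_of_ae_pos
    ((hVi.sub hVi2).congr (Eventually.of_forall fun ω => by simp; ring))
    (hV01.mono fun _ h => mul_pos h.1 (sub_pos.2 h.2))
  -- A constant `V` would make `Y` a multiple of `X`, impossible for an atomless `Y` independent of
  -- `X`.
  have hms : m ^ 2 < s := by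
    refine sq_integral_lt_integral_sq hV2 fun hc => ?_
    have hind : IndepFun (fun ω => (1 - m) / m * X ω) Y P :=
      hXY.comp (φ := fun x => (1 - m) / m * x) (ψ := id) (by fun_prop) measurable_id
    have hne := hind.ae_ne (hX.const_mul _) hY
    obtain ⟨ω, h1, h2, h3⟩ := (hc.and (hVU.and hne)).exists
    refine h3 ?_
    rw [← h2.1, ← h2.2, show V ω = m from h1]
    field_simp
  set M := mgf X P
  set N := mgf Y P
  set A := fun (n : ℕ) (t : ℝ) => ∫ ω, X ω ^ n * Real.exp (t * X ω) ∂P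
  set B := fun (n : ℕ) (t : ℝ) => ∫ ω, Y ω ^ n * Real.exp (t * Y ω) ∂P
  set T := fun (n : ℕ) (t : ℝ) => ∫ ω, U ω ^ n * Real.exp (t * U ω) ∂P
  have hIX := Iio_subset_interior_integrableExpSet hX hX0'
  have hIY := Iio_subset_interior_integrableExpSet hY hY0'
  have A0 : M = A 0 := by ext t; simp [M, A, mgf]
  have B0 : N = B 0 := by ext t; simp [N, B, mgf]
  have A_pos (n : ℕ) (t : ℝ) (ht : t < 0) : 0 < A n t :=
    integral_pos_of_ae_pos (integrable_pow_mul_exp_of_mem_interior_integrableExpSet (hIX ht) n)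
      (hX0.mono fun ω h => by positivity)
  have B_pos (n : ℕ) (t : ℝ) (ht : t < 0) : 0 < B n t :=
    integral_pos_of_ae_pos (integrable_pow_mul_exp_of_mem_interior_integrableExpSet (hIY ht) n)
      (hY0.mono fun ω h => by positivity)
  have hA (n : ℕ) (t : ℝ) (ht : t < 0) : HasDerivAt (A n) (A (n + 1) t) t :=
    hasDerivAt_integral_pow_mul_exp_real (hIX ht) n
  have hB (n : ℕ) (t : ℝ) (ht : t < 0) : HasDerivAt (B n) (B (n + 1) t) t :=
    hasDerivAt_integral_pow_mul_exp_real (hIY ht) n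
  have key (i j : ℕ) (t : ℝ) :
      A i t * B j t = T (i + j) t * ∫ ω, V ω ^ i * (1 - V ω) ^ j ∂P := by
    refine hXY.integral_mul_integral_eq_of_ae_eq hX hY hU hV hUV
      (f := fun x => x ^ i * Real.exp (t * x)) (g := fun x => x ^ j * Real.exp (t * x))
      (h := fun x => x ^ (i + j) * Real.exp (t * x)) (k := fun v => v ^ i * (1 - v) ^ j)
      (by fun_prop) (by fun_prop) (by fun_prop) (by fun_prop) ?_
    filter_upwards [hVU] with ω h
    have e : Real.exp (t * U ω) = Real.exp (t * X ω) * Real.exp (t * Y ω) := by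
      rw [← Real.exp_add, ← mul_add]
    rw [e]
    conv_lhs => rw [show X ω ^ i = (V ω * U ω) ^ i by rw [h.1],
      show Y ω ^ j = ((1 - V ω) * U ω) ^ j by rw [h.2], mul_pow, mul_pow]
    ring
  have k10 (t : ℝ) : A 1 t * B 0 t = T 1 t * m := by simpa using key 1 0 t
  have k01 (t : ℝ) : A 0 t * B 1 t = T 1 t * (1 - m) := by simpa [hm'] using key 0 1 t
  have k20 (t : ℝ) : A 2 t * B 0 t = T 2 t * s := by simpa using key 2 0 t
  have k11 (t : ℝ) : A 1 t * B 1 t = T 2 t * (m - s) := by simpa [hq] using key 1 1 t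
  have hYX (t : ℝ) : (1 - m) * (A 1 t * B 0 t) = m * (A 0 t * B 1 t) := by
    rw [k10, k01]; ring
  have hAA (t : ℝ) (ht : t < 0) : A 2 t * A 0 t = s * (1 - m) / ((m - s) * m) * A 1 t ^ 2 := by
    have h2 : (m - s) * (A 2 t * B 0 t) = s * (A 1 t * B 1 t) := by
      rw [k20, k11]; ring
    have hB0 := (B_pos 0 t ht).ne'
    field_simp
    refine mul_right_cancel₀ hB0 ?_
    linear_combination A 0 t * m * h2 - s * A 1 t * hYX t
  -- After clearing denominators this is exactly `m ^ 2 < s`.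
  have hk : 1 < s * (1 - m) / ((m - s) * m) := by
    rw [one_lt_div (by positivity)]
    linarith
  obtain ⟨a, ha, hrel⟩ := exists_mul_sub_eq_of_mul_eq_sq hk (hA 0) (hA 1) (A_pos 0) (A_pos 1) hAA
  set p := (s * (1 - m) / ((m - s) * m) - 1)⁻¹
  have hp : 0 < p := inv_pos.2 (sub_pos.2 hk)
  have hq : 0 < (1 - m) / m * p := by positivity
  have hrelY (t : ℝ) (ht : t < 0) : B 1 t * (a - t) = (1 - m) / m * p * B 0 t := by
    have hA0 := (A_pos 0 t ht).ne'
    field_simp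
    refine mul_right_cancel₀ hA0 ?_
    linear_combination -(a - t) * hYX t + (1 - m) * B 0 t * hrel t ht
  have limX : Tendsto M (𝓝[<] 0) (𝓝 1) := by simpa using tendsto_mgf_left hX hX0'
  have limY : Tendsto N (𝓝[<] 0) (𝓝 1) := by simpa using tendsto_mgf_left hY hY0'
  obtain ⟨ha0, hMX⟩ := eq_rpow_of_hasDerivAt ha hp (hA 0) hrel (A0 ▸ limX)
  obtain ⟨-, hMY⟩ := eq_rpow_of_hasDerivAt ha hq (hB 0) hrelY (B0 ▸ limY)
  exact ⟨p, (1 - m) / m * p, a, hp, hq, ha0,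
    hasLaw_gammaMeasure_of_mgf_eq hX hX0' hp ha0 fun t ht => (congrFun A0 t).trans (hMX t ht),
    hasLaw_gammaMeasure_of_mgf_eq hY hY0' hq ha0 fun t ht => (congrFun B0 t).trans (hMY t ht)⟩

end Lukacs

theorem ae_pos_of_hasLaw_restrict_Ioi {Ω : Type*} {mΩ : MeasurableSpace Ω} {P : Measure Ω}
    {X : Ω → ℝ} {f : ℝ → ENNReal}
    (hX : HasLaw X ((volume.restrict (Ioi 0)).withDensity f) P) : ∀ᵐ ω ∂P, 0 < X ω := by
  refine (ae_map_iff hX.aemeasurable measurableSet_Ioi).1 ?_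
  rw [hX.map_eq]
  exact (withDensity_absolutelyContinuous _ _).ae_le (ae_restrict_mem measurableSet_Ioi)

theorem mainTheorem1 {Ω : Type*} [MeasurableSpace Ω] (P : Measure Ω) [IsProbabilityMeasure P]
    (X Y : Ω → ℝ) (f g : ℝ → ℝ)
    (hf_meas : AEMeasurable f (volume.restrict (Ioi 0)))
    (hg_meas : AEMeasurable g (volume.restrict (Ioi 0)))
    (hf_pos : ∀ x ∈ Ioi (0 : ℝ), 0 < f x)
    (hg_pos : ∀ x ∈ Ioi (0 : ℝ), 0 < g x)
    (hX : HasLaw X ((volume.restrict (Ioi 0)).withDensity (fun x => ENNReal.ofReal (f x))) P)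
    (hY : HasLaw Y ((volume.restrict (Ioi 0)).withDensity (fun x => ENNReal.ofReal (g x))) P)
    (hXY : IndepFun X Y P)
    (hUV : IndepFun (fun ω => X ω + Y ω) (fun ω => X ω / (X ω + Y ω)) P) :
    ∃ p q a : ℝ, 0 < p ∧ 0 < q ∧ 0 < a ∧
      HasLaw X (gammaMeasure p a) P ∧ HasLaw Y (gammaMeasure q a) P := by
  have : NullSingletonClass (P.map Y) := by
    rw [hY.map_eq]
    infer_instance
  exact lukacs_of_ae_pos hX.aemeasurable hY.aemeasurable (ae_pos_of_hasLaw_restrict_Ioi hX)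
    (ae_pos_of_hasLaw_restrict_Ioi hY) hXY hUV
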